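/- **Theorem.** Let $F=(V;E,A)$ be a finite mixed graph with $V\neq\emptyset$, undirected edge set $E$ and arc set $A$; parallel edges and arcs are allowed, loops are not. Let $k\ge 0$ be an integer and let $f,g:V\to\mathbb{N}=\{0,1,2,\dots\}$ satisfy $f(v)\le g(v)$ for all $v\in V$. For $X\subseteq V$ write $\tilde f(X)=\sum_{x\in X}f(x)$ and $\tilde g(X)=\sum_{x\in X}g(x)$, and let $d_A^-(X)$ be the number of arcs in $A$ with tail outside $X$ and head in $X$. A *subpartition* of $V$ is a (possibly empty) family $\mathcal P=\{X_1,\dots,X_t\}$ of pairwise disjoint nonempty subsets of $V$; $e_E(\mathcal P)$ denotes the number of edges in $E$ having one end in some $X_i$ and the other end in some $X_j$ with $j\ne i$ or in $V\setminus\bigcup_{j=1}^t X_j$. A *mixed path* is a path in which every arc is traversed from its tail to its head, while undirected edges may be traversed in either direction. A subgraph $T$ of $F$ is a *mixed arborescence rooted at* $r\in V(T)$ if its underlying undirected multigraph is a tree and for every $u\in V(T)$ there is exactly one mixed path in $T$ from $r$ to $u$; it is *spanning* if $V(T)=V$. Then $F$ contains $k$ pairwise edge- and arc-disjoint spanning mixed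 arborescences $F_1,\dots,F_k$, with $F_i$ rooted at some $r_i\in V$ for $1\le i\le k$, such that $$f(v)\le |\{i\in\{1,\dots,k\}: r_i=v\}|\le g(v)\qquad\text{for all } v\in V,$$ if and only if the following three conditions hold: 1. $\tilde f(V)\le k$; 2. for every subpartition $\mathcal P=\{X_1,\dots,X_t\}$ of $V$, $$e_E(\mathcal P)+\sum_{j=1}^t d_A^-(X_j)\ \ge\ k(t-1)+\tilde f\Bigl(V\setminus\bigcup_{j=1}^t X_j\Bigr);$$ 3. for every subpartition $\mathcal P=\{X_1,\dots,X_t\}$ of $V$, $$e_E(\mathcal P)+\sum_{j=1}^t d_A^-(X_j)\ \ge\ kt-\tilde g\Bigl(\bigcup_{j=1}^t X_j\Bigr).$$ -/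

import Mathlib

/-- A mixed graph `F = (V; E, A)` with vertex set `V`, undirected edges indexed by `E` and directed
arcs indexed by `A`. Parallel edges and arcs are allowed, loops are not. -/
structure MixedGraph (V E A : Type*) where
  /-- the unordered pair of ends of an undirected edge -/
  ends : E → Sym2 V
  /-- the tail of an arc -/
  src : A → V
  /-- the head of an arc -/
  tgt : A → V
  ends_not_isDiag : ∀ e, ¬ (ends e).IsDiag
  src_ne_tgt : ∀ a, src a ≠ tgt a

/-- `IsWalk step u p v`: the list `p = [(ℓ₁, w₁), …, (ℓₙ, wₙ)]` describes a walk
`u, ℓ₁, w₁, …, ℓₙ, wₙ = v`, where `step ℓ x y` says that `ℓ` may be traversed from `x` to `y`. -/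
def IsWalk {L V : Type*} (step : L → V → V → Prop) : V → List (L × V) → V → Prop
  | u, [], v => u = v
  | u, (l, w) :: p, v => step l u w ∧ IsWalk step w p v

/-- A path is a walk without repeated vertices. -/
def IsPath {L V : Type*} (step : L → V → V → Prop) (u : V) (p : List (L × V)) (v : V) : Prop :=
  IsWalk step u p v ∧ (u :: p.map Prod.snd).Nodup

/-- A cycle is a closed walk of positive length whose links are pairwise distinct and whose vertices
are pairwise distinct (apart from the coincidence of its two ends). Two parallel links form a cycle
of length two. -/
def IsCycle {L V : Type*} (step : L → V → V → Prop) (u : V) (p : List (L × V)) : Prop :=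
  IsWalk step u p u ∧ p ≠ [] ∧ (p.map Prod.fst).Nodup ∧ (p.map Prod.snd).Nodup

namespace MixedGraph

variable {V E A : Type*}

/-- A subgraph of a mixed graph. -/
structure Subgraph (F : MixedGraph V E A) where
  verts : Set V
  edges : Set E
  arcs : Set A
  ends_mem : ∀ e ∈ edges, ∀ v ∈ F.ends e, v ∈ verts
  src_mem : ∀ a ∈ arcs, F.src a ∈ verts
  tgt_mem : ∀ a ∈ arcs, F.tgt a ∈ verts

namespace Subgraph

variable {F : MixedGraph V E A}

/-- `T.Step ℓ u v`: the edge or arc `ℓ` of `T` can be traversed from `u` to `v`, where an edge can be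
traversed in both directions and an arc only from its tail to its head. -/
def Step (T : F.Subgraph) : E ⊕ A → V → V → Prop
  | Sum.inl e, u, v => e ∈ T.edges ∧ F.ends e = s(u, v)
  | Sum.inr a, u, v => a ∈ T.arcs ∧ F.src a = u ∧ F.tgt a = v

/-- Traversal in the underlying undirected (multi)graph of `T`: directions of arcs are ignored. -/
def UStep (T : F.Subgraph) (l : E ⊕ A) (u v : V) : Prop :=
  T.Step l u v ∨ T.Step l v u

/-- The underlying undirected (multi)graph of `T` is a tree: nonempty, connected, and acyclic. -/
structure IsTree (T : F.Subgraph) : Prop where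
  nonempty : T.verts.Nonempty
  connected : ∀ u ∈ T.verts, ∀ v ∈ T.verts, ∃ p, IsWalk T.UStep u p v
  acyclic : ∀ u p, ¬ IsCycle T.UStep u p

/-- `T` is an `r`-mixed arborescence: its underlying graph is a tree, and for every vertex `u` of
`T` there is exactly one mixed path in `T` from `r` to `u`. -/
structure IsMixedArborescence (T : F.Subgraph) (r : V) : Prop where
  isTree : T.IsTree
  root_mem : r ∈ T.verts
  existsUnique_path : ∀ u ∈ T.verts, ∃! p, IsPath T.Step r p u

/-- `T` contains all vertices of the mixed graph. -/
def IsSpanning (T : F.Subgraph) : Prop := T.verts = Set.univ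

end Subgraph

/-- The number `e_E(P)` of edges with one end in some member `X` of `P` and the other end in another
member of `P` or outside the union of `P`. -/
noncomputable def crossingEdges [DecidableEq V] (F : MixedGraph V E A) (P : Finset (Finset V)) : ℕ :=
  Set.ncard {e : E | ∃ u v : V, F.ends e = s(u, v) ∧
    ∃ X ∈ P, u ∈ X ∧ ((∃ Y ∈ P, Y ≠ X ∧ v ∈ Y) ∨ v ∉ P.biUnion id)}

/-- The number `d_A^-(X)` of arcs that enter `X`. -/
noncomputable def inDegree (F : MixedGraph V E A) (X : Finset V) : ℕ :=
  Set.ncard {a : A | F.src a ∉ X ∧ F.tgt a ∈ X}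

/-- `F` contains `k` edge- and arc-disjoint spanning mixed arborescences, the `i`-th one rooted at
some vertex `r i`, such that every vertex `v` is the root of at least `f v` and at most `g v`
of them. -/
def HasPacking [DecidableEq V] (F : MixedGraph V E A) (k : ℕ) (f g : V → ℕ) : Prop :=
  ∃ (T : Fin k → F.Subgraph) (r : Fin k → V),
    (∀ i, (T i).IsSpanning ∧ (T i).IsMixedArborescence (r i)) ∧
    (∀ i j, i ≠ j → Disjoint (T i).edges (T j).edges ∧ Disjoint (T i).arcs (T j).arcs) ∧
    ∀ v, f v ≤ (Finset.univ.filter fun i => r i = v).card ∧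
      (Finset.univ.filter fun i => r i = v).card ≤ g v

end MixedGraph

/-- A subpartition of `V`: a family of pairwise disjoint nonempty subsets of `V`. -/
structure IsSubpartition {V : Type*} (P : Finset (Finset V)) : Prop where
  nonempty : ∀ X ∈ P, X.Nonempty
  disjoint : ∀ X ∈ P, ∀ Y ∈ P, X ≠ Y → Disjoint X Y

/-! For a prescribed root vector m with m(V) = k, a packing with exactly m(v) roots at each v exists
iff k|P| ≤ entering(P) + m(⋃P) for every subpartition P, where entering(P) = e_E(P) + ∑ d_A^-(X)
counts the links that can be traversed into a member of P. The theorem combines this with the choice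
of m between f and g.

Necessity: each arborescence enters every member avoiding its root, through distinct links
(`exists_entering_links`), and at most one member contains the root. Inserting f ≤ m ≤ g and m(V) =
k gives the stated conditions.

Sufficiency rests on uncrossing (`exists_uncrossing`): P and Q can be replaced by subpartitions R of
⋃P ∪ ⋃Q and T of ⋃P ∩ ⋃Q with |P| + |Q| ≤ |R| + |T|, while the entering count does not grow. Two
tight subpartitions thus yield a contradiction in two places: when f cannot be raised nor g lowered
at a vertex with f(v) < g(v) (`exists_roots`), and when neither direction of an edge can be
discarded (`exists_orientation`). Once all edges are oriented, one-member subpartitions give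
Edmonds' cut condition, and `exists_disjoint_branchings` supplies the arborescences. -/

open Finset

/-! ### Merging and intersecting subpartitions -/

section Uncrossing

variable {V : Type*}

theorem IsSubpartition.eq_of_mem {P : Finset (Finset V)} (hP : IsSubpartition P) {X Y : Finset V}
    (hX : X ∈ P) (hY : Y ∈ P) {v : V} (hvX : v ∈ X) (hvY : v ∈ Y) : X = Y := by
  by_contra h
  exact (Finset.disjoint_left.1 (hP.disjoint X hX Y hY h)) hvX hvY

theorem IsSubpartition.mono {P Q : Finset (Finset V)} (hP : IsSubpartition P) (h : Q ⊆ P) :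
    IsSubpartition Q :=
  ⟨fun X hX => hP.nonempty X (h hX), fun X hX Y hY => hP.disjoint X (h hX) Y (h hY)⟩

theorem isSubpartition_singleton {X : Finset V} (hX : X.Nonempty) : IsSubpartition {X} := by
  constructor
  · simpa using hX
  · intro A hA B hB hAB
    simp only [mem_singleton] at hA hB
    exact absurd (hA.trans hB.symm) hAB

variable [DecidableEq V]

/-- The pairs of members of `P` and `Q` that meet. -/
def meetingPairs (P Q : Finset (Finset V)) : Finset (Finset V × Finset V) :=
  (P ×ˢ Q).filter fun p => (p.1 ∩ p.2).Nonempty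

/-- Merging the members of two subpartitions along their intersections. The bound on the number
of parts says that a graph has at least as many components as vertices minus edges. -/
theorem exists_merge {P : Finset (Finset V)} (hP : IsSubpartition P) (Q : Finset (Finset V))
    (hQ : IsSubpartition Q) :
    ∃ R, IsSubpartition R ∧ R.biUnion id = P.biUnion id ∪ Q.biUnion id ∧
      P.card + Q.card ≤ R.card + (meetingPairs P Q).card ∧
      (∀ X ∈ P, ∃ C ∈ R, X ⊆ C) ∧ ∀ Y ∈ Q, ∃ C ∈ R, Y ⊆ C := by
  induction Q using Finset.induction_on with
  | empty => exact ⟨P, hP, by simp, by simp, fun X hX => ⟨X, hX, Subset.rfl⟩, by simp⟩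
  | insert Y Q hYQ ih =>
    obtain ⟨R, hR, hRu, hRc, hPR, hQR⟩ := ih (hQ.mono (subset_insert _ _))
    set M := R.filter fun C => (C ∩ Y).Nonempty with hM
    set N := R.filter fun C => ¬ (C ∩ Y).Nonempty with hN
    set Z := Y ∪ M.biUnion id with hZ
    have hYne : Y.Nonempty := hQ.nonempty Y (mem_insert_self _ _)
    have hYZ : Y ⊆ Z := subset_union_left
    have hNZ : ∀ C ∈ N, Disjoint C Z := by
      intro C hC
      rw [hN, mem_filter, not_nonempty_iff_eq_empty] at hC
      rw [hZ, disjoint_union_right, disjoint_biUnion_right]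
      refine ⟨disjoint_iff_inter_eq_empty.2 hC.2, fun D hD => ?_⟩
      rw [hM, mem_filter] at hD
      refine hR.disjoint C hC.1 D hD.1 ?_
      rintro rfl
      exact hD.2.ne_empty hC.2
    have hZN : Z ∉ N := fun h => by
      have := hNZ Z h
      rw [disjoint_self_iff_empty] at this
      exact (hYne.mono hYZ).ne_empty this
    have hcov : ∀ C ∈ R, ∃ D ∈ insert Z N, C ⊆ D := by
      intro C hC
      by_cases h : (C ∩ Y).Nonempty
      · refine ⟨Z, mem_insert_self _ _, ?_⟩
        exact (subset_biUnion_of_mem id (mem_filter.2 ⟨hC, h⟩)).trans subset_union_right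
      · exact ⟨C, mem_insert_of_mem (mem_filter.2 ⟨hC, h⟩), Subset.rfl⟩
    refine ⟨insert Z N, ⟨?_, ?_⟩, ?_, ?_, ?_, ?_⟩
    · intro X hX
      rcases mem_insert.1 hX with rfl | hX
      · exact hYne.mono hYZ
      · exact hR.nonempty X (mem_filter.1 hX).1
    · intro A hA B hB hAB
      rcases mem_insert.1 hA with rfl | hA <;> rcases mem_insert.1 hB with rfl | hB
      · exact absurd rfl hAB
      · exact (hNZ B hB).symm
      · exact hNZ A hA
      · exact hR.disjoint A (mem_filter.1 hA).1 B (mem_filter.1 hB).1 hAB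
    · have hMN : M.biUnion id ∪ N.biUnion id = R.biUnion id := by
        rw [← union_biUnion, hM, hN, filter_union_filter_not_eq]
      rw [biUnion_insert, biUnion_insert, id, hZ, union_assoc, hMN, hRu]
      ext x
      simp only [mem_union, id]
      tauto
    · have h1 : R.card = M.card + N.card := by
        rw [hM, hN, card_filter_add_card_filter_not]
      have h2 : (meetingPairs P (insert Y Q)).card =
          (meetingPairs P Q).card + (P.filter fun X => (X ∩ Y).Nonempty).card := by
        have : meetingPairs P (insert Y Q) = meetingPairs P Q ∪
            (P.filter fun X => (X ∩ Y).Nonempty).image fun X => (X, Y) := by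
          ext ⟨A, B⟩
          simp only [meetingPairs, mem_filter, mem_product, mem_insert, mem_union, mem_image,
            Prod.mk.injEq]
          constructor
          · rintro ⟨⟨hA, rfl | hB⟩, h⟩
            · exact Or.inr ⟨A, ⟨hA, h⟩, rfl, rfl⟩
            · exact Or.inl ⟨⟨hA, hB⟩, h⟩
          · rintro (⟨⟨hA, hB⟩, h⟩ | ⟨A', ⟨hA, h⟩, rfl, rfl⟩)
            · exact ⟨⟨hA, Or.inr hB⟩, h⟩
            · exact ⟨⟨hA, Or.inl rfl⟩, h⟩
        rw [this, card_union_of_disjoint, card_image_of_injective]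
        · intro A B h
          exact (Prod.mk.inj h).1
        · rw [disjoint_left]
          rintro ⟨A, B⟩ h h'
          simp only [meetingPairs, mem_filter, mem_product, mem_image, Prod.mk.injEq] at h h'
          obtain ⟨_, _, _, rfl⟩ := h'
          exact hYQ h.1.2
      -- Merging loses |M| - 1 parts. A point of C ∩ Y with C ∈ M lies in no older member of Q,
      -- hence in some X ∈ P with X ⊆ C; so each C ∈ M accounts for its own new meeting pair (X, Y).
      have h3 : M.card ≤ (P.filter fun X => (X ∩ Y).Nonempty).card := by
        have : ∀ C ∈ M, ∃ X ∈ P.filter (fun X => (X ∩ Y).Nonempty), X ⊆ C := by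
          intro C hC
          obtain ⟨hC, x, hx⟩ := mem_filter.1 hC
          rw [mem_inter] at hx
          have hxu : x ∈ P.biUnion id ∪ Q.biUnion id := hRu ▸ mem_biUnion.2 ⟨C, hC, hx.1⟩
          rcases mem_union.1 hxu with h | h
          · obtain ⟨X, hX, hxX⟩ := mem_biUnion.1 h
            obtain ⟨D, hD, hXD⟩ := hPR X hX
            refine ⟨X, mem_filter.2 ⟨hX, x, mem_inter.2 ⟨hxX, hx.2⟩⟩, ?_⟩
            rwa [hR.eq_of_mem hC hD hx.1 (hXD hxX)]
          · obtain ⟨Y', hY', hxY'⟩ := mem_biUnion.1 h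
            have := hQ.eq_of_mem (mem_insert_self Y Q) (mem_insert_of_mem hY') hx.2 hxY'
            exact absurd (this ▸ hY') hYQ
        choose! φ hφ hφs using this
        refine card_le_card_of_injOn φ hφ fun A hA B hB hAB => ?_
        obtain ⟨x, hx⟩ := hP.nonempty _ (mem_filter.1 (hφ A hA)).1
        exact hR.eq_of_mem (mem_filter.1 hA).1 (mem_filter.1 hB).1 (hφs A hA hx)
          (hφs B hB (hAB ▸ hx))
      rw [card_insert_of_notMem hYQ, card_insert_of_notMem hZN, h2]
      omega
    · intro X hX
      obtain ⟨C, hC, hXC⟩ := hPR X hX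
      obtain ⟨D, hD, hCD⟩ := hcov C hC
      exact ⟨D, hD, hXC.trans hCD⟩
    · intro X hX
      rcases mem_insert.1 hX with rfl | hX
      · exact ⟨Z, mem_insert_self _ _, hYZ⟩
      · obtain ⟨C, hC, hXC⟩ := hQR X hX
        obtain ⟨D, hD, hCD⟩ := hcov C hC
        exact ⟨D, hD, hXC.trans hCD⟩

/-- The subpartition of nonempty intersections of members of `P` with members of `Q`. -/
def commonRefinement (P Q : Finset (Finset V)) : Finset (Finset V) :=
  (meetingPairs P Q).image fun p => p.1 ∩ p.2

theorem mem_commonRefinement {P Q : Finset (Finset V)} {Z : Finset V} :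
    Z ∈ commonRefinement P Q ↔ ∃ X ∈ P, ∃ Y ∈ Q, (X ∩ Y).Nonempty ∧ X ∩ Y = Z := by
  simp only [commonRefinement, meetingPairs, mem_image, mem_filter, mem_product, Prod.exists]
  constructor
  · rintro ⟨X, Y, ⟨⟨hX, hY⟩, h⟩, rfl⟩
    exact ⟨X, hX, Y, hY, h, rfl⟩
  · rintro ⟨X, hX, Y, hY, h, rfl⟩
    exact ⟨X, Y, ⟨⟨hX, hY⟩, h⟩, rfl⟩

theorem IsSubpartition.commonRefinement {P Q : Finset (Finset V)} (hP : IsSubpartition P)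
    (hQ : IsSubpartition Q) : IsSubpartition (commonRefinement P Q) := by
  constructor
  · intro Z hZ
    obtain ⟨X, _, Y, _, h, rfl⟩ := mem_commonRefinement.1 hZ
    exact h
  · intro Z hZ Z' hZ' hne
    obtain ⟨X, hX, Y, hY, h, rfl⟩ := mem_commonRefinement.1 hZ
    obtain ⟨X', hX', Y', hY', h', rfl⟩ := mem_commonRefinement.1 hZ'
    rw [disjoint_left]
    intro v hv hv'
    rw [mem_inter] at hv hv'
    rw [hP.eq_of_mem hX hX' hv.1 hv'.1, hQ.eq_of_mem hY hY' hv.2 hv'.2] at hne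
    exact hne rfl

/-- A point of a nonempty intersection determines both members. With the bound of `exists_merge`
this gives |P| + |Q| ≤ |R| + |T|. -/
theorem card_commonRefinement {P Q : Finset (Finset V)} (hP : IsSubpartition P)
    (hQ : IsSubpartition Q) : (commonRefinement P Q).card = (meetingPairs P Q).card := by
  refine card_image_of_injOn ?_
  rintro ⟨X, Y⟩ h ⟨X', Y'⟩ h' heq
  simp only [meetingPairs, coe_filter, mem_product, Set.mem_ofPred_eq] at h h' heq
  obtain ⟨v, hv⟩ := h.2
  have hv' := heq ▸ hv
  rw [mem_inter] at hv hv'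
  rw [hP.eq_of_mem h.1.1 h'.1.1 hv.1 hv'.1, hQ.eq_of_mem h.1.2 h'.1.2 hv.2 hv'.2]

theorem biUnion_commonRefinement (P Q : Finset (Finset V)) :
    (commonRefinement P Q).biUnion id = P.biUnion id ∩ Q.biUnion id := by
  ext v
  simp only [mem_biUnion, id, mem_inter, mem_commonRefinement]
  constructor
  · rintro ⟨_, ⟨X, hX, Y, hY, _, rfl⟩, hv⟩
    rw [mem_inter] at hv
    exact ⟨⟨X, hX, hv.1⟩, ⟨Y, hY, hv.2⟩⟩
  · rintro ⟨⟨X, hX, hvX⟩, ⟨Y, hY, hvY⟩⟩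
    have hv := mem_inter.2 ⟨hvX, hvY⟩
    exact ⟨X ∩ Y, ⟨X, hX, Y, hY, ⟨v, hv⟩, rfl⟩, hv⟩

end Uncrossing

/-! ### Submodularity of the entering count -/

section Covering

variable {V L : Type*}

/-- In the system `S` of traversals `(ℓ, u, v)`, the link `ℓ` can be traversed into some member
of `P`. -/
def Enters (S : Finset (L × V × V)) (P : Finset (Finset V)) (ℓ : L) : Prop :=
  ∃ X ∈ P, ∃ u v, (ℓ, u, v) ∈ S ∧ u ∉ X ∧ v ∈ X

open Classical in
/-- The number of links that can be traversed into some member of `P`. -/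
noncomputable def entering [Fintype L] (S : Finset (L × V × V)) (P : Finset (Finset V)) : ℕ :=
  (univ.filter fun ℓ => Enters S P ℓ).card

/-- Any two traversals of a link agree or are opposite to each other. -/
def IsMixed (S : Finset (L × V × V)) : Prop :=
  ∀ ℓ u v u' v', (ℓ, u, v) ∈ S → (ℓ, u', v') ∈ S → (u = u' ∧ v = v') ∨ (u = v' ∧ v = u')

variable [DecidableEq V]

/-- The uncrossing inequality, link by link. A link entering C ∈ R at v enters the member of P or Q
around v, which lies inside C; a link entering X ∩ Y starts outside X or outside Y. If a link does
both, even in opposite directions, its end outside X ∩ Y lies outside the part of R containing X ∪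
Y, so it enters X and Y. -/
theorem enters_uncross {S : Finset (L × V × V)} (hS : IsMixed S) {P Q R : Finset (Finset V)}
    (hR : IsSubpartition R)
    (hRu : R.biUnion id = P.biUnion id ∪ Q.biUnion id)
    (hPR : ∀ X ∈ P, ∃ C ∈ R, X ⊆ C) (hQR : ∀ X ∈ Q, ∃ C ∈ R, X ⊆ C) (ℓ : L) :
    (Enters S R ℓ → Enters S P ℓ ∨ Enters S Q ℓ) ∧
    (Enters S (commonRefinement P Q) ℓ → Enters S P ℓ ∨ Enters S Q ℓ) ∧
    (Enters S R ℓ → Enters S (commonRefinement P Q) ℓ → Enters S P ℓ ∧ Enters S Q ℓ) := by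
  have sub : ∀ {T : Finset (Finset V)}, (∀ X ∈ T, ∃ C ∈ R, X ⊆ C) → ∀ C ∈ R, ∀ X ∈ T, ∀ v ∈ X,
      v ∈ C → X ⊆ C := by
    intro T hT C hC X hX v hvX hvC
    obtain ⟨D, hD, hXD⟩ := hT X hX
    rwa [hR.eq_of_mem hC hD hvC (hXD hvX)]
  refine ⟨?_, ?_, ?_⟩
  · rintro ⟨C, hC, u, v, hm, hu, hv⟩
    have : v ∈ P.biUnion id ∪ Q.biUnion id := hRu ▸ mem_biUnion.2 ⟨C, hC, hv⟩
    rcases mem_union.1 this with h | h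
    · obtain ⟨X, hX, hvX⟩ := mem_biUnion.1 h
      exact Or.inl ⟨X, hX, u, v, hm, fun h => hu (sub hPR C hC X hX v hvX hv h), hvX⟩
    · obtain ⟨X, hX, hvX⟩ := mem_biUnion.1 h
      exact Or.inr ⟨X, hX, u, v, hm, fun h => hu (sub hQR C hC X hX v hvX hv h), hvX⟩
  · rintro ⟨Z, hZ, u, v, hm, hu, hv⟩
    obtain ⟨X, hX, Y, hY, -, rfl⟩ := mem_commonRefinement.1 hZ
    rw [mem_inter] at hu hv
    by_cases h : u ∈ X
    · exact Or.inr ⟨Y, hY, u, v, hm, fun h' => hu ⟨h, h'⟩, hv.2⟩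
    · exact Or.inl ⟨X, hX, u, v, hm, h, hv.1⟩
  · rintro ⟨C, hC, u, v, hm, hu, hv⟩ ⟨Z, hZ, u', v', hm', hu', hv'⟩
    obtain ⟨X, hX, Y, hY, -, rfl⟩ := mem_commonRefinement.1 hZ
    rw [mem_inter] at hu' hv'
    obtain ⟨D, hD, hXD⟩ := hPR X hX
    have hYD : Y ⊆ D := sub hQR D hD Y hY v' hv'.2 (hXD hv'.1)
    have key : u' ∉ D := by
      rcases hS ℓ u v u' v' hm hm' with ⟨rfl, rfl⟩ | ⟨rfl, rfl⟩
      · rwa [hR.eq_of_mem hD hC (hXD hv'.1) hv]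
      · intro h
        exact hu (hR.eq_of_mem hC hD hv h ▸ hXD hv'.1)
    exact ⟨⟨X, hX, u', v', hm', fun h => key (hXD h), hv'.1⟩,
      ⟨Y, hY, u', v', hm', fun h => key (hYD h), hv'.2⟩⟩

variable [Fintype L]

/-- Subpartitions can be uncrossed. The inequality is strict if some link is entering for both
given subpartitions, but not for the one that covers the intersection. -/
theorem exists_uncrossing {S : Finset (L × V × V)} (hS : IsMixed S) {P Q : Finset (Finset V)}
    (hP : IsSubpartition P) (hQ : IsSubpartition Q) :
    ∃ R T, IsSubpartition R ∧ IsSubpartition T ∧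
      R.biUnion id = P.biUnion id ∪ Q.biUnion id ∧
      T.biUnion id = P.biUnion id ∩ Q.biUnion id ∧
      P.card + Q.card ≤ R.card + T.card ∧
      entering S R + entering S T ≤ entering S P + entering S Q ∧
      ((∃ ℓ, Enters S P ℓ ∧ Enters S Q ℓ ∧ ¬ Enters S T ℓ) →
        entering S R + entering S T < entering S P + entering S Q) := by
  classical
  obtain ⟨R, hR, hRu, hc, hPR, hQR⟩ := exists_merge hP Q hQ
  have hunc := enters_uncross hS hR hRu hPR hQR
  have hcard : ∀ T, entering S T = ∑ ℓ, if Enters S T ℓ then 1 else 0 := fun T => by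
    rw [entering, card_filter]
  have hle : ∀ ℓ ∈ (univ : Finset L), ((if Enters S R ℓ then 1 else 0) +
      if Enters S (commonRefinement P Q) ℓ then 1 else 0) ≤
      ((if Enters S P ℓ then 1 else 0) + if Enters S Q ℓ then 1 else 0 : ℕ) := by
    intro ℓ _
    have := hunc ℓ
    by_cases h1 : Enters S R ℓ <;> by_cases h2 : Enters S (commonRefinement P Q) ℓ <;>
    by_cases h3 : Enters S P ℓ <;> by_cases h4 : Enters S Q ℓ <;> simp_all
  refine ⟨R, commonRefinement P Q, hR, hP.commonRefinement hQ, hRu, biUnion_commonRefinement P Q,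
    ?_, ?_, ?_⟩
  · rwa [card_commonRefinement hP hQ]
  · simp only [hcard, ← sum_add_distrib]
    exact sum_le_sum hle
  · rintro ⟨ℓ, h1, h2, h3⟩
    simp only [hcard, ← sum_add_distrib]
    -- This link counts twice on the right and at most once on the left.
    refine sum_lt_sum hle ⟨ℓ, mem_univ ℓ, ?_⟩
    simp only [h1, h2, h3, if_true, if_false]
    split_ifs <;> norm_num

end Covering

/-! ### Choosing the root vector and orienting the edges -/

section Orientation

variable {V L : Type*} [Fintype L]

theorem entering_empty (S : Finset (L × V × V)) : entering S ∅ = 0 := by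
  simp [entering, Enters]

theorem entering_univ [Fintype V] (S : Finset (L × V × V)) : entering S {univ} = 0 := by
  simp [entering, Enters]

variable [DecidableEq V]

theorem sum_add_single (f : V → ℕ) (v : V) (U : Finset V) :
    ∑ x ∈ U, (f + Pi.single v 1 : V → ℕ) x = ∑ x ∈ U, f x + if v ∈ U then 1 else 0 := by
  simp only [Pi.add_apply, sum_add_distrib]
  rw [sum_pi_single']

theorem sub_single_add {g : V → ℕ} {v : V} (hv : 0 < g v) :
    g - Pi.single v 1 + Pi.single v 1 = g := by
  funext x
  by_cases h : x = v
  · subst h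
    simp only [Pi.add_apply, Pi.sub_apply, Pi.single_eq_same]
    omega
  · simp [h]

/-- Integral points of the contrapolymatroid of root vectors inside a box. -/
theorem exists_roots [Fintype V] [Nonempty V] {S : Finset (L × V × V)} (hS : IsMixed S) (k : ℕ)
    (f g : V → ℕ) (hfg : f ≤ g)
    (hf : ∀ P, IsSubpartition P →
      k * P.card + ∑ v ∈ univ \ P.biUnion id, f v ≤ entering S P + k)
    (hg : ∀ P, IsSubpartition P → k * P.card ≤ entering S P + ∑ v ∈ P.biUnion id, g v) :
    ∃ m : V → ℕ, f ≤ m ∧ m ≤ g ∧ ∑ v, m v = k ∧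
      ∀ P, IsSubpartition P → k * P.card ≤ entering S P + ∑ v ∈ P.biUnion id, m v := by
  induction hn : ∑ v, (g v - f v) using Nat.strong_induction_on generalizing f g with
  | _ n ih =>
    by_cases heq : f = g
    · subst heq
      -- The empty subpartition gives f(V) ≤ k, and {V} gives k ≤ g(V).
      refine ⟨f, le_rfl, le_rfl, le_antisymm ?_ ?_, hg⟩
      · simpa [entering_empty] using hf ∅ ⟨by simp, by simp⟩
      · simpa [entering_univ] using hg {univ} (isSubpartition_singleton univ_nonempty)
    obtain ⟨v, hv⟩ : ∃ v, f v < g v := by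
      by_contra! h
      exact heq (le_antisymm hfg h)
    -- Raise f or lower g by one at v if the respective condition survives; either way the total gap
    -- shrinks.
    by_cases h1 : ∀ P, IsSubpartition P →
        k * P.card + ∑ x ∈ univ \ P.biUnion id, (f + Pi.single v 1 : V → ℕ) x ≤ entering S P + k
    · have hle : f + Pi.single v 1 ≤ g := by
        intro x
        by_cases h : x = v
        · subst h
          simpa using hv
        · simpa [h] using hfg x
      obtain ⟨m, hm, hm'⟩ := ih _ (hn ▸ sum_lt_sum (fun x _ => by
        simp only [Pi.add_apply]; omega) ⟨v, mem_univ v, by simp; omega⟩) _ g hle h1 hg rfl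
      exact ⟨m, le_trans (fun x => by simp) hm, hm'⟩
    by_cases h2 : ∀ P, IsSubpartition P →
        k * P.card ≤ entering S P + ∑ x ∈ P.biUnion id, (g - Pi.single v 1 : V → ℕ) x
    · have hle : f ≤ g - Pi.single v 1 := by
        intro x
        by_cases h : x = v
        · subst h
          simp only [Pi.sub_apply, Pi.single_eq_same]
          omega
        · simpa [h] using hfg x
      obtain ⟨m, hm, hmg, hm'⟩ := ih _ (hn ▸ sum_lt_sum (fun x _ => by
        simp only [Pi.sub_apply]; omega) ⟨v, mem_univ v, by simp; omega⟩) f _ hle hf h2 rfl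
      exact ⟨m, hm, hmg.trans fun x => by simp, hm'⟩
    exfalso
    push Not at h1 h2
    obtain ⟨P, hP, hPlt⟩ := h1
    obtain ⟨Q, hQ, hQlt⟩ := h2
    -- P is tight for f and avoids v; Q is tight for g and covers v. The f-condition on R and the
    -- g-condition on T then force g(B \ A) ≤ f(B \ A) for A = ⋃P and B = ⋃Q, impossible since v ∈ B
    -- \ A.
    obtain ⟨R, T, hR, hT, hRu, hTu, hc, he, -⟩ := exists_uncrossing hS hP hQ
    have hfP := hf P hP
    have hgQ := hg Q hQ
    have hfR := hf R hR
    have hgT := hg T hT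
    have hgs : ∀ U : Finset V, ∑ x ∈ U, (g - Pi.single v 1 : V → ℕ) x + (if v ∈ U then 1 else 0) =
        ∑ x ∈ U, g x := fun U => by
      rw [← sum_add_single, sub_single_add (by omega)]
    rw [sum_add_single] at hPlt
    have hgs := hgs (Q.biUnion id)
    rw [hRu] at hfR
    rw [hTu] at hgT
    set A := P.biUnion id
    set B := Q.biUnion id
    have hvA : v ∉ A := by
      intro h
      simp only [mem_sdiff, h, not_true, and_false, if_false] at hPlt
      omega
    have hvB : v ∈ B := by
      by_contra h
      simp only [h, if_false] at hgs
      omega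
    simp only [mem_sdiff, mem_univ, hvA, not_false_eq_true, and_self, if_true] at hPlt
    simp only [hvB, if_true] at hgs
    have e1 : ∑ x ∈ univ \ A, f x = ∑ x ∈ univ \ (A ∪ B), f x + ∑ x ∈ B \ A, f x := by
      rw [← sum_union]
      · congr 1
        ext x
        simp only [mem_sdiff, mem_univ, mem_union]
        tauto
      · rw [disjoint_left]
        intro x
        simp only [mem_sdiff, mem_univ, mem_union]
        tauto
    have e2 : ∑ x ∈ B, g x = ∑ x ∈ A ∩ B, g x + ∑ x ∈ B \ A, g x := by
      rw [inter_comm, sum_inter_add_sum_sdiff]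
    have e3 : ∑ x ∈ B \ A, f x < ∑ x ∈ B \ A, g x :=
      sum_lt_sum (fun x _ => hfg x) ⟨v, mem_sdiff.2 ⟨hvB, hvA⟩, hv⟩
    have e4 := Nat.mul_le_mul_left k hc
    rw [mul_add, mul_add] at e4
    omega

/-- Deleting one traversal lowers the count by at most one, so a violated P was tight and `ℓ`
entered it only from `a` to `b`. Were `a` covered, the surviving reverse traversal would enter the
member around `a`. -/
theorem tight_of_erase [DecidableEq L] {S : Finset (L × V × V)} {k : ℕ}
    {m : V → ℕ} {ℓ : L} {a b : V} (hba : (ℓ, b, a) ∈ S) {P : Finset (Finset V)}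
    (hP : IsSubpartition P) (h : k * P.card ≤ entering S P + ∑ v ∈ P.biUnion id, m v)
    (h' : ¬ k * P.card ≤ entering (S.erase (ℓ, a, b)) P + ∑ v ∈ P.biUnion id, m v) :
    entering S P + ∑ v ∈ P.biUnion id, m v = k * P.card ∧ Enters S P ℓ ∧
      a ∉ P.biUnion id ∧ b ∈ P.biUnion id := by
  classical
  have hne : ∀ ℓ', ℓ' ≠ ℓ → Enters S P ℓ' → Enters (S.erase (ℓ, a, b)) P ℓ' := by
    rintro ℓ' hℓ ⟨X, hX, u, v, hm, huv⟩
    exact ⟨X, hX, u, v, mem_erase.2 ⟨fun h => hℓ (Prod.mk.inj h).1, hm⟩, huv⟩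
  have hle : entering S P ≤ entering (S.erase (ℓ, a, b)) P + 1 := by
    refine le_trans (card_le_card (t := insert ℓ (univ.filter fun ℓ' =>
      Enters (S.erase (ℓ, a, b)) P ℓ')) fun ℓ' hℓ' => ?_) (card_insert_le _ _)
    by_cases h : ℓ' = ℓ
    · exact h ▸ mem_insert_self _ _
    · exact mem_insert_of_mem (mem_filter.2 ⟨mem_univ _, hne ℓ' h (mem_filter.1 hℓ').2⟩)
  have hlt : ¬ entering S P ≤ entering (S.erase (ℓ, a, b)) P := by omega
  have hnot : ¬ (Enters S P ℓ → Enters (S.erase (ℓ, a, b)) P ℓ) := by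
    intro hi
    refine hlt (card_le_card fun ℓ' hℓ' => mem_filter.2 ⟨mem_univ _, ?_⟩)
    by_cases h : ℓ' = ℓ
    · subst h
      exact hi (mem_filter.1 hℓ').2
    · exact hne ℓ' h (mem_filter.1 hℓ').2
  rw [Classical.not_imp] at hnot
  obtain ⟨hin, hout⟩ := hnot
  refine ⟨by omega, hin, ?_⟩
  obtain ⟨X, hX, u, v, hm, hu, hv⟩ := hin
  obtain ⟨rfl, rfl⟩ : u = a ∧ v = b := by
    by_contra h
    refine hout ⟨X, hX, u, v, mem_erase.2 ⟨fun h' => h ?_, hm⟩, hu, hv⟩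
    simpa using h'
  refine ⟨fun h => ?_, mem_biUnion.2 ⟨X, hX, hv⟩⟩
  obtain ⟨Y, hY, huY⟩ := mem_biUnion.1 h
  refine hout ⟨Y, hY, v, u, mem_erase.2 ⟨fun h' => ?_, hba⟩, fun hvY => ?_, huY⟩
  · simp only [Prod.mk.injEq, true_and] at h'
    exact hu (h'.1 ▸ hv)
  · exact hu (hP.eq_of_mem hY hX hvY hv ▸ huY)

/-- Undirected links can be oriented without violating a covering condition. -/
theorem exists_orientation (k : ℕ) (m : V → ℕ) (S : Finset (L × V × V)) (hS : IsMixed S)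
    (h : ∀ P, IsSubpartition P → k * P.card ≤ entering S P + ∑ v ∈ P.biUnion id, m v) :
    ∃ D ⊆ S, (∀ ℓ u v u' v', (ℓ, u, v) ∈ D → (ℓ, u', v') ∈ D → u = u' ∧ v = v') ∧
      ∀ P, IsSubpartition P → k * P.card ≤ entering D P + ∑ v ∈ P.biUnion id, m v := by
  classical
  induction S using Finset.strongInduction with
  | H S ih =>
    have step : ∀ x ∈ S, (∀ P, IsSubpartition P →
        k * P.card ≤ entering (S.erase x) P + ∑ v ∈ P.biUnion id, m v) →
        ∃ D ⊆ S, (∀ ℓ u v u' v', (ℓ, u, v) ∈ D → (ℓ, u', v') ∈ D → u = u' ∧ v = v') ∧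
        ∀ P, IsSubpartition P → k * P.card ≤ entering D P + ∑ v ∈ P.biUnion id, m v := by
      intro x hx hP
      obtain ⟨D, hD, hD'⟩ := ih (S.erase x) (erase_ssubset hx) (fun ℓ u v u' v' h1 h2 =>
        hS ℓ u v u' v' (mem_of_mem_erase h1) (mem_of_mem_erase h2)) hP
      exact ⟨D, hD.trans (erase_subset _ _), hD'⟩
    by_cases hdir : ∀ ℓ u v u' v', (ℓ, u, v) ∈ S → (ℓ, u', v') ∈ S → u = u' ∧ v = v'
    · exact ⟨S, Subset.rfl, hdir, h⟩
    push Not at hdir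
    obtain ⟨ℓ, a, b, a', b', hab, hba, hne⟩ := hdir
    rcases hS ℓ a b a' b' hab hba with ⟨h1, h2⟩ | ⟨rfl, rfl⟩
    · exact absurd h2 (hne h1)
    by_cases h1 : ∀ P, IsSubpartition P →
        k * P.card ≤ entering (S.erase (ℓ, a, b)) P + ∑ v ∈ P.biUnion id, m v
    · exact step _ hab h1
    by_cases h2 : ∀ P, IsSubpartition P →
        k * P.card ≤ entering (S.erase (ℓ, b, a)) P + ∑ v ∈ P.biUnion id, m v
    · exact step _ hba h2
    exfalso
    simp only [not_forall] at h1 h2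
    obtain ⟨P, hP, hPlt⟩ := h1
    obtain ⟨Q, hQ, hQlt⟩ := h2
    obtain ⟨hPe, hPℓ, haP, hbP⟩ := tight_of_erase hba hP (h P hP) hPlt
    obtain ⟨hQe, hQℓ, hbQ, haQ⟩ := tight_of_erase hab hQ (h Q hQ) hQlt
    obtain ⟨R, T, hR, hT, hRu, hTu, hc, -, he⟩ := exists_uncrossing hS hP hQ
    -- ⋃P contains b but not a, and ⋃Q contains a but not b. So `ℓ` enters both P and Q, but has no
    -- end in ⋃T = ⋃P ∩ ⋃Q, which makes the uncrossing strict. As P and Q are tight and m is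
    -- modular, R or T would violate the condition.
    have he := he ⟨ℓ, hPℓ, hQℓ, by
      rintro ⟨X, hX, u, v, hm, -, hv⟩
      have hvT : v ∈ T.biUnion id := mem_biUnion.2 ⟨X, hX, hv⟩
      rw [hTu, mem_inter] at hvT
      rcases hS ℓ a b u v hab hm with ⟨rfl, rfl⟩ | ⟨rfl, rfl⟩
      · exact hbQ hvT.2
      · exact haP hvT.1⟩
    have hmod := sum_union_inter (s₁ := P.biUnion id) (s₂ := Q.biUnion id) (f := m)
    rw [← hRu, ← hTu] at hmod
    have hR := h R hR
    have hT := h T hT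
    have e4 := Nat.mul_le_mul_left k hc
    rw [mul_add, mul_add] at e4
    omega

end Orientation

/-! ### Edmonds' disjoint branchings -/

section Branchings

variable {V L : Type*} [DecidableEq V]

/-- The number of arcs of `D` that enter `X`. -/
def arcsInto (D : Finset (L × V × V)) (X : Finset V) : ℕ :=
  (D.filter fun a => a.2.1 ∉ X ∧ a.2.2 ∈ X).card

theorem arcsInto_submodular (D : Finset (L × V × V)) (X Y : Finset V) :
    arcsInto D (X ∪ Y) + arcsInto D (X ∩ Y) ≤ arcsInto D X + arcsInto D Y := by
  simp only [arcsInto, card_filter, ← sum_add_distrib]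
  refine sum_le_sum fun a _ => ?_
  simp only [mem_union, mem_inter]
  by_cases h1 : a.2.1 ∈ X <;> by_cases h2 : a.2.1 ∈ Y <;> by_cases h3 : a.2.2 ∈ X <;>
    by_cases h4 : a.2.2 ∈ Y <;> simp [h1, h2, h3, h4]

/-- The number of sets of the family `W` that miss `X`. -/
def missing {k : ℕ} (W : Fin k → Finset V) (X : Finset V) : ℕ :=
  (univ.filter fun i => Disjoint (W i) X).card

theorem missing_term (W X Y : Finset V) :
    ((if Disjoint W X then 1 else 0) + if Disjoint W Y then 1 else 0) ≤
    ((if Disjoint W (X ∪ Y) then 1 else 0) + if Disjoint W (X ∩ Y) then 1 else 0 : ℕ) := by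
  simp only [disjoint_union_right]
  by_cases h1 : Disjoint W X
  · have : Disjoint W (X ∩ Y) := h1.mono_right inter_subset_left
    by_cases h2 : Disjoint W Y <;> simp [h1, h2, this]
  · by_cases h2 : Disjoint W Y
    · have : Disjoint W (X ∩ Y) := h2.mono_right inter_subset_right
      simp [h1, h2, this]
    · simp [h1, h2]

theorem missing_supermodular {k : ℕ} (W : Fin k → Finset V) (X Y : Finset V) :
    missing W X + missing W Y ≤ missing W (X ∪ Y) + missing W (X ∩ Y) := by
  simp only [missing, card_filter, ← sum_add_distrib]
  exact sum_le_sum fun i _ => missing_term (W i) X Y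

/-- The set `W i` contributes nothing on the left and one on the right, through the intersection. -/
theorem missing_supermodular_lt {k : ℕ} (W : Fin k → Finset V) (X Y : Finset V) (i : Fin k)
    (hX : ¬ Disjoint (W i) X) (hY : ¬ Disjoint (W i) Y) (hXY : Disjoint (W i) (X ∩ Y)) :
    missing W X + missing W Y < missing W (X ∪ Y) + missing W (X ∩ Y) := by
  simp only [missing, card_filter, ← sum_add_distrib]
  exact sum_lt_sum (fun i _ => missing_term (W i) X Y) ⟨i, mem_univ i, by simp [hX, hY, hXY]⟩

/-- Some arc leaving `W i` can be moved from `D` to the `i`-th branching. -/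
theorem exists_safe_arc [Fintype V] {k : ℕ} (D : Finset (L × V × V)) (W : Fin k → Finset V)
    (h : ∀ X : Finset V, X.Nonempty → missing W X ≤ arcsInto D X) (i : Fin k)
    (hi : W i ≠ univ) :
    ∃ ℓ u v, (ℓ, u, v) ∈ D ∧ u ∈ W i ∧ v ∉ W i ∧ ∀ X : Finset V, v ∈ X → u ∉ X →
      ¬ Disjoint (W i) X → missing W X < arcsInto D X := by
  -- These are the sets that could make an arc leaving `W i` unsafe: tight, meeting `W i`, and not
  -- contained in it.
  set C : Finset (Finset V) := univ.filter fun X => missing W X = arcsInto D X ∧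
    ¬ Disjoint (W i) X ∧ (X \ W i).Nonempty with hC
  have hmis : ∀ X, ¬ Disjoint (W i) X → missing W X < missing W (X \ W i) := by
    intro X hX
    refine card_lt_card ((ssubset_iff_of_subset fun j hj => ?_).2 ⟨i, ?_, ?_⟩)
    · exact mem_filter.2 ⟨mem_univ _, (mem_filter.1 hj).2.mono_right sdiff_subset⟩
    · exact mem_filter.2 ⟨mem_univ _, disjoint_sdiff⟩
    · simpa using hX
  by_cases hCe : C.Nonempty
  · obtain ⟨X, hXC, hmin⟩ := C.exists_min_image card hCe
    rw [hC, mem_filter] at hXC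
    obtain ⟨-, hXt, hXi, hXn⟩ := hXC
    -- For a minimal critical X, more arcs enter X \ W i than X, so some arc runs from X ∩ W i to X
    -- \ W i; this arc is safe.
    have hlt : arcsInto D X < arcsInto D (X \ W i) :=
      hXt ▸ (hmis X hXi).trans_le (h _ hXn)
    obtain ⟨⟨ℓ, u, v⟩, ha, hna⟩ := exists_mem_notMem_of_card_lt_card hlt
    simp only [mem_filter, mem_sdiff, not_and, not_not] at ha hna
    obtain ⟨haD, hu, hv, hvi⟩ := ha
    have huX : u ∈ X := by
      by_contra h
      exact hna haD h hv
    have huW := hu huX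
    refine ⟨ℓ, u, v, haD, huW, hvi, fun Y hvY huY hYi => ?_⟩
    refine lt_of_le_of_ne (h Y ⟨v, hvY⟩) fun hYt => ?_
    have hvXY : v ∈ X ∩ Y := mem_inter.2 ⟨hv, hvY⟩
    have h1 := h (X ∩ Y) ⟨v, hvXY⟩
    have h2 := h (X ∪ Y) ⟨v, mem_union_left _ hv⟩
    have h3 := arcsInto_submodular D X Y
    have h4 := missing_supermodular W X Y
    -- X and Y are tight, so strict supermodularity would violate the cut condition on X ∪ Y or X ∩
    -- Y. Hence X ∩ Y is itself critical, and it is smaller than X because it misses u.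
    have hXYi : ¬ Disjoint (W i) (X ∩ Y) := fun hd => by
      have := missing_supermodular_lt W X Y i hXi hYi hd
      omega
    have := hmin (X ∩ Y) (mem_filter.2 ⟨mem_univ _, by omega, hXYi,
      ⟨v, mem_sdiff.2 ⟨hvXY, hvi⟩⟩⟩)
    have hss : X ∩ Y ⊂ X := (ssubset_iff_of_subset inter_subset_left).2
      ⟨u, huX, fun h => huY (mem_inter.1 h).2⟩
    exact absurd (card_lt_card hss) (by omega)
  · have hn : (univ \ W i).Nonempty := by
      rw [nonempty_iff_ne_empty, Ne, sdiff_eq_empty_iff_subset, univ_subset_iff]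
      exact hi
    have hpos : 0 < missing W (univ \ W i) :=
      card_pos.2 ⟨i, mem_filter.2 ⟨mem_univ _, disjoint_sdiff⟩⟩
    obtain ⟨⟨ℓ, u, v⟩, ha⟩ := card_pos.1 (hpos.trans_le (h _ hn))
    simp only [mem_filter, mem_sdiff, mem_univ, true_and, not_not] at ha
    refine ⟨ℓ, u, v, ha.1, ha.2.1, ha.2.2, fun Y hvY huY hYi => ?_⟩
    refine lt_of_le_of_ne (h Y ⟨v, hvY⟩) fun hYt => hCe ⟨Y, mem_filter.2 ⟨mem_univ _, hYt, hYi,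
      ⟨v, mem_sdiff.2 ⟨hvY, ha.2.2⟩⟩⟩⟩

variable [DecidableEq L]

/-- The arc set `B` is grown from the root `r`, one arc leaving the current vertex set at a time,
and has final vertex set `W`. An arc is a triple of its label, tail and head. -/
inductive IsBranching (r : V) : Finset V → Finset (L × V × V) → Prop
  | root : IsBranching r {r} ∅
  | grow {W : Finset V} {B : Finset (L × V × V)} {ℓ : L} {u v : V} (h : IsBranching r W B)
      (hu : u ∈ W) (hv : v ∉ W) : IsBranching r (insert v W) (insert (ℓ, u, v) B)

/-- Edmonds' disjoint branchings theorem. -/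
theorem exists_disjoint_branchings [Fintype V] {k : ℕ} (r : Fin k → V) (D₀ : Finset (L × V × V))
    (D : Finset (L × V × V)) (hD : D ⊆ D₀) (W : Fin k → Finset V)
    (B : Fin k → Finset (L × V × V)) (hB : ∀ i, IsBranching (r i) (W i) (B i))
    (hBD : ∀ i, B i ⊆ D₀ \ D) (hdis : ∀ i j, i ≠ j → Disjoint (B i) (B j))
    (h : ∀ X : Finset V, X.Nonempty → missing W X ≤ arcsInto D X) :
    ∃ B' : Fin k → Finset (L × V × V), (∀ i, IsBranching (r i) univ (B' i)) ∧
      (∀ i, B' i ⊆ D₀) ∧ ∀ i j, i ≠ j → Disjoint (B' i) (B' j) := by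
  induction D using Finset.strongInduction generalizing W B with
  | H D ih =>
    by_cases hall : ∀ i, W i = univ
    · exact ⟨B, fun i => hall i ▸ hB i, fun i => (hBD i).trans sdiff_subset, hdis⟩
    push Not at hall
    obtain ⟨i, hi⟩ := hall
    obtain ⟨ℓ, u, v, ha, hu, hv, hsafe⟩ := exists_safe_arc D W h i hi
    have hdis' : ∀ j, j ≠ i → Disjoint (insert (ℓ, u, v) (B i)) (B j) := by
      intro j hj
      rw [disjoint_insert_left]
      exact ⟨fun hm => (mem_sdiff.1 (hBD j hm)).2 ha, hdis i j hj.symm⟩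
    refine ih (D.erase (ℓ, u, v)) (erase_ssubset ha) ((erase_subset _ _).trans hD)
      (Function.update W i (insert v (W i))) (Function.update B i (insert (ℓ, u, v) (B i)))
      ?_ ?_ ?_ ?_
    · intro j
      by_cases hj : j = i
      · subst hj
        simpa using (hB j).grow hu hv
      · simpa [hj] using hB j
    · intro j
      by_cases hj : j = i
      · subst hj
        simp only [Function.update_self]
        refine insert_subset (mem_sdiff.2 ⟨hD ha, notMem_erase _ _⟩) ((hBD j).trans ?_)
        exact sdiff_subset_sdiff Subset.rfl (erase_subset _ _)
      · simp only [Function.update_of_ne hj]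
        exact (hBD j).trans (sdiff_subset_sdiff Subset.rfl (erase_subset _ _))
    · intro j j' hne
      by_cases hj : j = i
      · subst hj
        simpa [hne.symm] using hdis' j' hne.symm
      · by_cases hj' : j' = i
        · subst hj'
          simpa [hj] using (hdis' j hj).symm
        · simpa [hj, hj'] using hdis j j' hne
    · intro X hX
      have hmle : missing (Function.update W i (insert v (W i))) X ≤ missing W X := by
        refine card_le_card fun j hj => mem_filter.2 ⟨mem_univ _, ?_⟩
        have hj := (mem_filter.1 hj).2
        by_cases hji : j = i
        · subst hji
          simp only [Function.update_self, disjoint_insert_left] at hj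
          exact hj.2
        · simpa [hji] using hj
      -- Only sets entered by the moved arc lose an in-arc. If X missed `W i`, its demand drops as
      -- well, since v ∈ X; otherwise safety provides the slack.
      by_cases hent : u ∉ X ∧ v ∈ X
      · have harc : arcsInto D X = arcsInto (D.erase (ℓ, u, v)) X + 1 := by
          rw [arcsInto, arcsInto, filter_erase, card_erase_add_one]
          exact mem_filter.2 ⟨ha, hent⟩
        by_cases hX' : Disjoint (W i) X
        · have : missing (Function.update W i (insert v (W i))) X < missing W X := by
            refine card_lt_card ((ssubset_iff_of_subset fun j hj => ?_).2
              ⟨i, mem_filter.2 ⟨mem_univ _, hX'⟩, ?_⟩)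
            · refine mem_filter.2 ⟨mem_univ _, ?_⟩
              have hj := (mem_filter.1 hj).2
              by_cases hji : j = i
              · exact hji ▸ hX'
              · simpa [hji] using hj
            · simp [disjoint_insert_left, hent.2]
          have := h X hX
          omega
        · have := hsafe X hent.2 hent.1 hX'
          omega
      · have harc : arcsInto (D.erase (ℓ, u, v)) X = arcsInto D X := by
          rw [arcsInto, arcsInto, filter_erase, erase_eq_of_notMem]
          exact fun h => hent (mem_filter.1 h).2
        rw [harc]
        exact hmle.trans (h X hX)

end Branchings

/-! ### Walks, trails and cycles in oriented forests -/

section Walks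

variable {V L : Type*}

theorem IsWalk.mono {s s' : L → V → V → Prop} (h : ∀ ℓ x y, s ℓ x y → s' ℓ x y) {u v : V}
    {p : List (L × V)} (hp : IsWalk s u p v) : IsWalk s' u p v := by
  induction p generalizing u with
  | nil => exact hp
  | cons a p ih => exact ⟨h _ _ _ hp.1, ih hp.2⟩

theorem IsWalk.append {s : L → V → V → Prop} {u v w : V} {p q : List (L × V)}
    (hp : IsWalk s u p v) (hq : IsWalk s v q w) : IsWalk s u (p ++ q) w := by
  induction p generalizing u with
  | nil =>
    obtain rfl : u = v := hp
    exact hq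
  | cons a p ih => exact ⟨hp.1, ih hp.2⟩

theorem isWalk_concat {s : L → V → V → Prop} {u v w : V} {p : List (L × V)} {ℓ : L} :
    IsWalk s u (p ++ [(ℓ, w)]) v ↔ ∃ x, IsWalk s u p x ∧ s ℓ x w ∧ w = v := by
  constructor
  · intro h
    induction p generalizing u with
    | nil => exact ⟨u, rfl, h.1, h.2⟩
    | cons a p ih =>
      obtain ⟨x, hx, h'⟩ := ih h.2
      exact ⟨x, ⟨h.1, hx⟩, h'⟩
  · rintro ⟨x, hx, h, rfl⟩
    exact hx.append ⟨h, rfl⟩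

theorem IsWalk.exists_reverse {s : L → V → V → Prop} (hs : ∀ ℓ x y, s ℓ x y → s ℓ y x) {u v : V}
    {p : List (L × V)} (hp : IsWalk s u p v) : ∃ q, IsWalk s v q u := by
  induction p generalizing u with
  | nil => exact ⟨[], Eq.symm hp⟩
  | cons a p ih =>
    obtain ⟨q, hq⟩ := ih hp.2
    exact ⟨q ++ [(a.1, u)], isWalk_concat.2 ⟨_, hq, hs _ _ _ hp.1, rfl⟩⟩

/-- The arcs `ℓ` from `x` to `y` with `fwd ℓ x y` enter each vertex at most once and increase
the height `n`. -/
structure IsForest (fwd : L → V → V → Prop) (n : V → ℕ) : Prop where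
  inj : ∀ {ℓ ℓ' x x' y}, fwd ℓ x y → fwd ℓ' x' y → ℓ = ℓ' ∧ x = x'
  lt : ∀ {ℓ x y}, fwd ℓ x y → n x < n y

variable {fwd u : L → V → V → Prop} {n : V → ℕ}

theorem IsForest.le_of_walk (hF : IsForest fwd n) {x y : V} {p : List (L × V)}
    (hp : IsWalk fwd x p y) : n x ≤ n y := by
  induction p generalizing x with
  | nil => exact le_of_eq (congrArg n hp)
  | cons a p ih => exact (hF.lt hp.1).le.trans (ih hp.2)

theorem IsForest.lt_of_mem_walk (hF : IsForest fwd n) {x y z : V} {p : List (L × V)}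
    (hp : IsWalk fwd x p y) (hz : z ∈ p.map Prod.snd) : n x < n z := by
  induction p generalizing x with
  | nil => simp at hz
  | cons a p ih =>
    rw [List.map_cons, List.mem_cons] at hz
    rcases hz with rfl | hz
    · exact hF.lt hp.1
    · exact (hF.lt hp.1).trans (ih hp.2 hz)

theorem IsForest.isPath (hF : IsForest fwd n) {x y : V} {p : List (L × V)}
    (hp : IsWalk fwd x p y) : IsPath fwd x p y := by
  refine ⟨hp, ?_⟩
  induction p generalizing x with
  | nil => simp
  | cons a p ih =>
    rw [List.nodup_cons]
    exact ⟨fun h => (hF.lt_of_mem_walk hp h).ne rfl, ih hp.2⟩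

/-- Read backwards from the end: each vertex has at most one entering arc, and the root has none. -/
theorem IsForest.walk_unique (hF : IsForest fwd n) {r : V} (hr : ∀ ℓ x, ¬ fwd ℓ x r) {y : V}
    {p q : List (L × V)} (hp : IsWalk fwd r p y) (hq : IsWalk fwd r q y) : p = q := by
  induction p using List.reverseRecOn generalizing y q with
  | nil =>
    obtain rfl : r = y := hp
    rcases q.eq_nil_or_concat' with rfl | ⟨q, ⟨ℓ, w⟩, rfl⟩
    · rfl
    · obtain ⟨x, -, h, rfl⟩ := isWalk_concat.1 hq
      exact absurd h (hr _ _)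
  | append_singleton p a ih =>
    obtain ⟨ℓ, w⟩ := a
    obtain ⟨x, hpx, h, rfl⟩ := isWalk_concat.1 hp
    rcases q.eq_nil_or_concat' with rfl | ⟨q, ⟨ℓ', w'⟩, rfl⟩
    · obtain rfl : r = w := hq
      exact absurd h (hr _ _)
    · obtain ⟨x', hqx, h', rfl⟩ := isWalk_concat.1 hq
      obtain ⟨rfl, rfl⟩ := hF.inj h h'
      rw [ih hpx hqx]

/-- A path that does not visit the tails of the arcs entering its first vertex is directed. -/
theorem IsForest.directed_of_path (hF : IsForest fwd n)
    (hu : ∀ ℓ x y, u ℓ x y → fwd ℓ x y ∨ fwd ℓ y x) {x y : V} {p : List (L × V)}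
    (hp : IsWalk u x p y) (hnd : (x :: p.map Prod.snd).Nodup)
    (hx : ∀ ℓ z, fwd ℓ z x → z ∉ p.map Prod.snd) : IsWalk fwd x p y := by
  induction p generalizing x with
  | nil => exact hp
  | cons a p ih =>
    obtain ⟨ℓ, w⟩ := a
    have hfwd : fwd ℓ x w := (hu _ _ _ hp.1).resolve_right fun h => hx _ _ h (by simp)
    rw [List.map_cons, List.nodup_cons] at hnd
    refine ⟨hfwd, ih hp.2 hnd.2 fun ℓ' z hz hmem => hnd.1 ?_⟩
    rw [(hF.inj hfwd hz).2]
    exact List.mem_cons_of_mem _ hmem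

/-- A trail that does not use the arcs entering its first vertex is directed. -/
theorem IsForest.directed_of_trail (hF : IsForest fwd n)
    (hu : ∀ ℓ x y, u ℓ x y → fwd ℓ x y ∨ fwd ℓ y x) {x y : V} {p : List (L × V)}
    (hp : IsWalk u x p y) (hnd : (p.map Prod.fst).Nodup)
    (hx : ∀ ℓ z, fwd ℓ z x → ℓ ∉ p.map Prod.fst) : IsWalk fwd x p y := by
  induction p generalizing x with
  | nil => exact hp
  | cons a p ih =>
    obtain ⟨ℓ, w⟩ := a
    have hfwd : fwd ℓ x w := (hu _ _ _ hp.1).resolve_right fun h => hx _ _ h (by simp)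
    rw [List.map_cons, List.nodup_cons] at hnd
    refine ⟨hfwd, ih hp.2 hnd.2 fun ℓ' z hz hmem => hnd.1 ?_⟩
    rwa [(hF.inj hfwd hz).1]

theorem exists_last_of_walk {x y : V} {p : List (L × V)} (hp : IsWalk fwd x p y) (hne : p ≠ []) :
    ∃ ℓ ∈ p.map Prod.fst, ∃ z, fwd ℓ z y := by
  rcases p.eq_nil_or_concat' with rfl | ⟨p, ⟨ℓ, w⟩, rfl⟩
  · exact absurd rfl hne
  · obtain ⟨z, -, h, rfl⟩ := isWalk_concat.1 hp
    exact ⟨ℓ, by simp, z, h⟩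

/-- A trail goes down all the way, or ends with a forward step. -/
theorem IsForest.trail_descends_or (hF : IsForest fwd n)
    (hu : ∀ ℓ x y, u ℓ x y → fwd ℓ x y ∨ fwd ℓ y x) {x y : V} {p : List (L × V)}
    (hp : IsWalk u x p y) (hnd : (p.map Prod.fst).Nodup) :
    n y ≤ n x ∨ ∃ ℓ ∈ p.map Prod.fst, ∃ z, fwd ℓ z y := by
  induction p generalizing x with
  | nil => exact Or.inl (le_of_eq (congrArg n (Eq.symm hp)))
  | cons a p ih =>
    obtain ⟨ℓ, w⟩ := a
    rw [List.map_cons, List.nodup_cons] at hnd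
    rcases hu _ _ _ hp.1 with h | h
    · have hp' := hF.directed_of_trail hu hp.2 hnd.2 fun ℓ' z hz hmem =>
        hnd.1 ((hF.inj h hz).1 ▸ hmem)
      exact Or.inr (exists_last_of_walk (p := (ℓ, w) :: p) ⟨h, hp'⟩ (by simp))
    · rcases ih hp.2 hnd.2 with hle | ⟨ℓ', hℓ', z, hz⟩
      · exact Or.inl (hle.trans (hF.lt h).le)
      · exact Or.inr ⟨ℓ', List.mem_cons_of_mem _ hℓ', z, hz⟩

/-- A closed trail starting forward stays forward and gains height. One starting backward either
only descends, or ends with a forward step into `x`, which must reuse the first link, the only arc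
entering `x`. -/
theorem IsForest.not_isCycle (hF : IsForest fwd n)
    (hu : ∀ ℓ x y, u ℓ x y → fwd ℓ x y ∨ fwd ℓ y x) (x : V) (p : List (L × V)) :
    ¬ IsCycle u x p := by
  rintro ⟨hp, hne, hnd, -⟩
  cases p with
  | nil => exact hne rfl
  | cons a p =>
    obtain ⟨ℓ, w⟩ := a
    rw [List.map_cons, List.nodup_cons] at hnd
    rcases hu _ _ _ hp.1 with h | h
    · have hp' := hF.directed_of_trail hu hp.2 hnd.2 fun ℓ' z hz hmem =>
        hnd.1 ((hF.inj h hz).1 ▸ hmem)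
      exact absurd (hF.lt h) (hF.le_of_walk hp').not_gt
    · rcases hF.trail_descends_or hu hp.2 hnd.2 with hle | ⟨ℓ', hℓ', z, hz⟩
      · exact absurd (hF.lt h) hle.not_gt
      · exact hnd.1 ((hF.inj h hz).1 ▸ hℓ')

end Walks

/-! ### Structure of branchings -/

namespace IsBranching

variable {V L : Type*} [DecidableEq V] [DecidableEq L] {r : V} {W : Finset V}
  {B : Finset (L × V × V)}

theorem mem_verts (h : IsBranching r W B) {ℓ : L} {x y : V} (ha : (ℓ, x, y) ∈ B) :
    x ∈ W ∧ y ∈ W := by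
  induction h with
  | root => simp at ha
  | grow _ hu _ ih =>
    rcases mem_insert.1 ha with ha | ha
    · obtain ⟨rfl, rfl, rfl⟩ : _ = _ ∧ _ = _ ∧ _ = _ := by simpa using ha
      exact ⟨mem_insert_of_mem hu, mem_insert_self _ _⟩
    · exact ⟨mem_insert_of_mem (ih ha).1, mem_insert_of_mem (ih ha).2⟩

theorem root_mem (h : IsBranching r W B) : r ∈ W := by
  induction h with
  | root => simp
  | grow _ _ _ ih => exact mem_insert_of_mem ih

theorem notMem_root (h : IsBranching r W B) (ℓ : L) (x : V) : (ℓ, x, r) ∉ B := by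
  induction h with
  | root => simp
  | grow h _ hv ih =>
    intro ha
    rcases mem_insert.1 ha with ha | ha
    · obtain ⟨rfl, rfl, rfl⟩ : _ = _ ∧ _ = _ ∧ _ = _ := by simpa using ha
      exact hv h.root_mem
    · exact ih ha

theorem exists_isForest (h : IsBranching r W B) :
    ∃ n : V → ℕ, IsForest (fun ℓ x y => (ℓ, x, y) ∈ B) n := by
  induction h with
  | root => exact ⟨0, by simp, by simp⟩
  | @grow W B ℓ₀ u v h hu hv ih =>
    obtain ⟨n, hinj, hlt⟩ := ih
    -- The height is the depth in the branching; since v is new, no earlier arc is affected.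
    refine ⟨Function.update n v (n u + 1), ?_, ?_⟩
    · intro ℓ ℓ' x x' y ha ha'
      rw [mem_insert, Prod.mk.injEq, Prod.mk.injEq] at ha ha'
      rcases ha with ⟨rfl, rfl, rfl⟩ | ha <;> rcases ha' with ⟨rfl, rfl, hy⟩ | ha'
      · exact ⟨rfl, rfl⟩
      · exact absurd (h.mem_verts ha').2 hv
      · exact absurd (hy ▸ (h.mem_verts ha).2) hv
      · exact hinj ha ha'
    · intro ℓ x y ha
      rw [mem_insert, Prod.mk.injEq, Prod.mk.injEq] at ha
      rcases ha with ⟨rfl, rfl, rfl⟩ | ha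
      · rw [Function.update_self, Function.update_of_ne (by rintro rfl; exact hv hu)]
        exact Nat.lt_succ_self _
      · have hm := h.mem_verts ha
        rw [Function.update_of_ne (by rintro rfl; exact hv hm.1),
          Function.update_of_ne (by rintro rfl; exact hv hm.2)]
        exact hlt ha

theorem exists_walk (h : IsBranching r W B) {y : V} (hy : y ∈ W) :
    ∃ p, IsWalk (fun ℓ x y => (ℓ, x, y) ∈ B) r p y := by
  induction h generalizing y with
  | root => exact ⟨[], (mem_singleton.1 hy).symm⟩
  | @grow W B ℓ u v h hu _ ih =>
    have hmono : ∀ ℓ' x y, (ℓ', x, y) ∈ B → (ℓ', x, y) ∈ insert (ℓ, u, v) B :=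
      fun _ _ _ => mem_insert_of_mem
    rcases mem_insert.1 hy with rfl | hy
    · obtain ⟨p, hp⟩ := ih hu
      exact ⟨p ++ [(ℓ, y)], isWalk_concat.2 ⟨u, hp.mono hmono, mem_insert_self _ _, rfl⟩⟩
    · obtain ⟨p, hp⟩ := ih hy
      exact ⟨p, hp.mono hmono⟩

end IsBranching

/-! ### From branchings to mixed arborescences -/

namespace MixedGraph

variable {V E A : Type*}

/-- `F.Step ℓ u v`: the edge or arc `ℓ` of `F` can be traversed from `u` to `v`. -/
def Step (F : MixedGraph V E A) : E ⊕ A → V → V → Prop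
  | Sum.inl e, u, v => F.ends e = s(u, v)
  | Sum.inr a, u, v => F.src a = u ∧ F.tgt a = v

theorem Step.eq_or_eq {F : MixedGraph V E A} {ℓ : E ⊕ A} {u v u' v' : V} (h : F.Step ℓ u v)
    (h' : F.Step ℓ u' v') : (u = u' ∧ v = v') ∨ (u = v' ∧ v = u') := by
  cases ℓ with
  | inl e => exact Sym2.eq_iff.1 (Eq.symm h |>.trans h')
  | inr a => exact Or.inl ⟨h.1.symm.trans h'.1, h.2.symm.trans h'.2⟩

theorem Subgraph.Step.toStep {F : MixedGraph V E A} {T : F.Subgraph} {ℓ : E ⊕ A} {u v : V}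
    (h : T.Step ℓ u v) : F.Step ℓ u v := by
  cases ℓ <;> exact h.2

/-- The spanning subgraph formed by the links of a set of traversals. -/
def spanningSubgraph (F : MixedGraph V E A) (B : Finset ((E ⊕ A) × V × V)) : F.Subgraph where
  verts := Set.univ
  edges := {e | ∃ u v, (Sum.inl e, u, v) ∈ B}
  arcs := {a | ∃ u v, (Sum.inr a, u, v) ∈ B}
  ends_mem := by simp
  src_mem := by simp
  tgt_mem := by simp

variable [Fintype V] [DecidableEq V] [DecidableEq E] [DecidableEq A]

/-- A branching of traversals that reaches all vertices is a mixed arborescence. -/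
theorem isMixedArborescence_spanningSubgraph {F : MixedGraph V E A}
    {B : Finset ((E ⊕ A) × V × V)} (hBF : ∀ ℓ u v, (ℓ, u, v) ∈ B → F.Step ℓ u v) {r : V}
    (hB : IsBranching r univ B) : (F.spanningSubgraph B).IsMixedArborescence r := by
  obtain ⟨n, hF⟩ := hB.exists_isForest
  set T := F.spanningSubgraph B
  have hfwd : ∀ ℓ x y, (ℓ, x, y) ∈ B → T.Step ℓ x y := by
    rintro (e | a) x y h
    · exact ⟨⟨x, y, h⟩, hBF _ _ _ h⟩
    · exact ⟨⟨x, y, h⟩, hBF _ _ _ h⟩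
  have hstep : ∀ ℓ x y, T.Step ℓ x y → (ℓ, x, y) ∈ B ∨ (ℓ, y, x) ∈ B := by
    intro ℓ x y h
    obtain ⟨x', y', h'⟩ : ∃ x' y', (ℓ, x', y') ∈ B := by
      cases ℓ <;> exact h.1
    rcases h.toStep.eq_or_eq (hBF _ _ _ h') with ⟨rfl, rfl⟩ | ⟨rfl, rfl⟩
    · exact Or.inl h'
    · exact Or.inr h'
  have hustep : ∀ ℓ x y, T.UStep ℓ x y → (ℓ, x, y) ∈ B ∨ (ℓ, y, x) ∈ B := by
    rintro ℓ x y (h | h)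
    · exact hstep _ _ _ h
    · exact (hstep _ _ _ h).symm
  refine ⟨⟨⟨r, Set.mem_univ r⟩, fun x _ y _ => ?_, hF.not_isCycle hustep⟩, Set.mem_univ r,
    fun y _ => ?_⟩
  · obtain ⟨p, hp⟩ := hB.exists_walk (mem_univ x)
    obtain ⟨q, hq⟩ := hB.exists_walk (mem_univ y)
    have hsub : ∀ ℓ x y, (ℓ, x, y) ∈ B → T.UStep ℓ x y := fun _ _ _ h => Or.inl (hfwd _ _ _ h)
    obtain ⟨p', hp'⟩ := (hp.mono hsub).exists_reverse fun _ _ _ h => Or.symm h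
    exact ⟨p' ++ q, hp'.append (hq.mono hsub)⟩
  · obtain ⟨p, hp⟩ := hB.exists_walk (mem_univ y)
    refine ⟨p, ⟨hp.mono hfwd, (hF.isPath hp).2⟩, fun q hq => ?_⟩
    -- A mixed path may traverse an edge against its orientation in `B`, but no arc enters the root,
    -- so a path from the root never does.
    exact hF.walk_unique hB.notMem_root (hF.directed_of_path hstep hq.1 hq.2
      fun ℓ z hz => absurd hz (hB.notMem_root ℓ z)) hp

end MixedGraph

/-! ### Packings and the covering condition -/

/-- This is the last entrance of the path into `X`. Both prefixes are kept as paths from `r` so that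
their lengths can be compared when an edge is used in opposite directions. -/
theorem IsPath.exists_entering_step {V L : Type*} {s : L → V → V → Prop} {r y : V}
    {p : List (L × V)} (hp : IsPath s r p y) {X : Finset V} (hr : r ∉ X) (hy : y ∈ X) :
    ∃ q ℓ u v, IsPath s r q u ∧ IsPath s r (q ++ [(ℓ, v)]) v ∧ s ℓ u v ∧ u ∉ X ∧ v ∈ X := by
  induction p using List.reverseRecOn generalizing y with
  | nil =>
    obtain rfl : r = y := hp.1
    exact absurd hy hr
  | append_singleton p a ih =>
    obtain ⟨ℓ, w⟩ := a
    obtain ⟨x, hpx, h, rfl⟩ := isWalk_concat.1 hp.1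
    have hpath : IsPath s r p x := by
      refine ⟨hpx, hp.2.sublist ?_⟩
      rw [List.map_append]
      exact (List.sublist_append_left _ _).cons_cons r
    by_cases hx : x ∈ X
    · exact ih hpath hx
    · exact ⟨p, ℓ, x, w, hpath, hp, h, hx, hy⟩

theorem sum_card_roots {V : Type*} [DecidableEq V] {k : ℕ} (r : Fin k → V) (U : Finset V) :
    ∑ v ∈ U, (univ.filter fun i => r i = v).card = (univ.filter fun i => r i ∈ U).card := by
  rw [card_eq_sum_card_fiberwise (s := univ.filter fun i => r i ∈ U) (f := r) (t := U)
    fun i hi => (mem_filter.1 hi).2]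
  refine sum_congr rfl fun v hv => ?_
  rw [filter_filter]
  congr 1
  ext i
  simp only [mem_filter, mem_univ, true_and]
  exact ⟨fun h => ⟨h ▸ hv, h⟩, fun h => h.2⟩

namespace MixedGraph

variable {V E A : Type*}

/-- Distinct members of a subpartition avoiding the root are entered by distinct links of a
spanning mixed arborescence. -/
theorem exists_entering_links [DecidableEq V] {F : MixedGraph V E A} {T : F.Subgraph} {r : V}
    (hs : T.IsSpanning) (hT : T.IsMixedArborescence r) {P : Finset (Finset V)}
    (hP : IsSubpartition P) :
    ∃ I : Finset (E ⊕ A), (P.filter fun X => r ∉ X).card = I.card ∧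
      ∀ ℓ ∈ I, ∃ X ∈ P, ∃ u v, T.Step ℓ u v ∧ u ∉ X ∧ v ∈ X := by
  classical
  have huniq : ∀ {u p q}, IsPath T.Step r p u → IsPath T.Step r q u → p = q := fun {u p q} hp hq =>
    (hT.existsUnique_path u (hs ▸ Set.mem_univ u)).unique hp hq
  have hex : ∀ X : {X // X ∈ P.filter fun X => r ∉ X}, ∃ ℓ u v q, IsPath T.Step r q u ∧
      IsPath T.Step r (q ++ [(ℓ, v)]) v ∧ T.Step ℓ u v ∧ u ∉ X.1 ∧ v ∈ X.1 := by
    rintro ⟨X, hX⟩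
    obtain ⟨hX, hr⟩ := mem_filter.1 hX
    obtain ⟨y, hy⟩ := hP.nonempty X hX
    obtain ⟨p, hp, -⟩ := hT.existsUnique_path y (hs ▸ Set.mem_univ y)
    obtain ⟨q, ℓ, u, v, h⟩ := hp.exists_entering_step hr hy
    exact ⟨ℓ, u, v, q, h⟩
  choose φ u v q hq hqv hφ hu hv using hex
  refine ⟨univ.image φ, ?_, fun ℓ hℓ => ?_⟩
  · rw [card_image_of_injective, card_univ, Fintype.card_coe]
    intro X Y heq
    rcases (heq ▸ hφ X).toStep.eq_or_eq (hφ Y).toStep with ⟨-, h⟩ | ⟨h1, h2⟩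
    · exact Subtype.ext (hP.eq_of_mem (mem_filter.1 X.2).1 (mem_filter.1 Y.2).1 (hv X) (h ▸ hv Y))
    -- If one edge served two members in opposite directions, uniqueness of paths from the root
    -- would make each of the two prefixes one step longer than the other.
    · have l1 := congrArg List.length (huniq (hq X) (h1 ▸ hqv Y))
      have l2 := congrArg List.length (huniq (hq Y) (h2 ▸ hqv X))
      simp only [List.length_append, List.length_singleton] at l1 l2
      omega
  · obtain ⟨X, -, rfl⟩ := mem_image.1 hℓ
    exact ⟨X.1, (mem_filter.1 X.2).1, u X, v X, hφ X, hu X, hv X⟩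

variable [Fintype V] [Fintype E] [Fintype A]

open Classical in
/-- All traversals of the links of `F`. -/
noncomputable def traversals (F : MixedGraph V E A) : Finset ((E ⊕ A) × V × V) :=
  univ.filter fun a => F.Step a.1 a.2.1 a.2.2

theorem mem_traversals {F : MixedGraph V E A} {ℓ : E ⊕ A} {u v : V} :
    (ℓ, u, v) ∈ F.traversals ↔ F.Step ℓ u v := by
  simp [traversals]

theorem isMixed_traversals (F : MixedGraph V E A) : IsMixed F.traversals :=
  fun _ _ _ _ _ h h' => (mem_traversals.1 h).eq_or_eq (mem_traversals.1 h')

variable [DecidableEq V]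

/-- An edge counts once even if it enters two members, whereas an arc enters only the member
containing its head, so the in-degrees add up without overlap. -/
theorem entering_traversals (F : MixedGraph V E A) {P : Finset (Finset V)}
    (hP : IsSubpartition P) :
    entering F.traversals P = F.crossingEdges P + ∑ X ∈ P, F.inDegree X := by
  classical
  have hsum : (univ.filter fun ℓ => Enters F.traversals P ℓ) =
      (univ.filter fun e => Enters F.traversals P (Sum.inl e)).disjSum
        (univ.filter fun a => Enters F.traversals P (Sum.inr a)) := by
    ext (e | a) <;> simp
  rw [entering, hsum, card_disjSum]
  congr 1
  · rw [crossingEdges, ← Set.ncard_coe_finset]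
    congr 1
    ext e
    simp only [coe_filter, mem_univ, true_and, Set.mem_ofPred_eq]
    constructor
    · rintro ⟨X, hX, u, v, hm, hu, hv⟩
      refine ⟨v, u, (mem_traversals.1 hm).trans Sym2.eq_swap, X, hX, hv, ?_⟩
      by_cases h : u ∈ P.biUnion id
      · obtain ⟨Y, hY, huY⟩ := mem_biUnion.1 h
        exact Or.inl ⟨Y, hY, fun h => hu (h ▸ huY), huY⟩
      · exact Or.inr h
    · rintro ⟨u, v, he, X, hX, hu, h⟩
      refine ⟨X, hX, v, u, mem_traversals.2 (he.trans Sym2.eq_swap), ?_, hu⟩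
      rcases h with ⟨Y, hY, hne, hv⟩ | h
      · exact fun hvX => hne (hP.eq_of_mem hY hX hv hvX)
      · exact fun hvX => h (mem_biUnion.2 ⟨X, hX, hvX⟩)
  · have hin : ∀ X ∈ P, F.inDegree X = (univ.filter fun a => F.src a ∉ X ∧ F.tgt a ∈ X).card := by
      intro X _
      rw [inDegree, ← Set.ncard_coe_finset]
      congr 1
      ext a
      simp
    rw [sum_congr rfl hin, ← card_biUnion]
    · congr 1
      ext a
      simp only [Enters, mem_traversals, Step, mem_filter, mem_univ, true_and, mem_biUnion]
      constructor
      · rintro ⟨X, hX, _, _, ⟨rfl, rfl⟩, h⟩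
        exact ⟨X, hX, h⟩
      · rintro ⟨X, hX, h⟩
        exact ⟨X, hX, _, _, ⟨rfl, rfl⟩, h⟩
    · intro X hX Y hY hne
      rw [Function.onFun, disjoint_left]
      intro a h h'
      exact hne (hP.eq_of_mem hX hY (mem_filter.1 h).2.2 (mem_filter.1 h').2.2)

/-- A packing of spanning mixed arborescences satisfies the covering condition. -/
theorem le_entering_of_packing {F : MixedGraph V E A} {k : ℕ} {T : Fin k → F.Subgraph}
    {r : Fin k → V} (hT : ∀ i, (T i).IsSpanning ∧ (T i).IsMixedArborescence (r i))
    (hdis : ∀ i j, i ≠ j → Disjoint (T i).edges (T j).edges ∧ Disjoint (T i).arcs (T j).arcs)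
    {P : Finset (Finset V)} (hP : IsSubpartition P) :
    k * P.card ≤ entering F.traversals P +
      ∑ v ∈ P.biUnion id, (univ.filter fun i => r i = v).card := by
  classical
  choose I hIcard hI using fun i => exists_entering_links (hT i).1 (hT i).2 hP
  have hent : ∑ i, (P.filter fun X => r i ∉ X).card ≤ entering F.traversals P := by
    simp only [hIcard]
    rw [← card_biUnion]
    · refine card_le_card fun ℓ hℓ => mem_filter.2 ⟨mem_univ _, ?_⟩
      obtain ⟨i, -, hℓ⟩ := mem_biUnion.1 hℓ
      obtain ⟨X, hX, u, v, hs, huv⟩ := hI i ℓ hℓ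
      exact ⟨X, hX, u, v, mem_traversals.2 hs.toStep, huv⟩
    · intro i _ j _ hij
      rw [Function.onFun, disjoint_left]
      intro ℓ hi hj
      obtain ⟨-, -, u, v, hs, -⟩ := hI i ℓ hi
      obtain ⟨-, -, u', v', hs', -⟩ := hI j ℓ hj
      cases ℓ with
      | inl e => exact Set.disjoint_left.1 (hdis i j hij).1 hs.1 hs'.1
      | inr a => exact Set.disjoint_left.1 (hdis i j hij).2 hs.1 hs'.1
  -- At most one member contains the root, since members are disjoint.
  have hi : ∀ i ∈ (univ : Finset (Fin k)), P.card ≤ (P.filter fun X => r i ∉ X).card +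
      if r i ∈ P.biUnion id then 1 else 0 := by
    intro i _
    rw [← card_filter_add_card_filter_not (s := P) fun X => r i ∈ X, add_comm]
    refine Nat.add_le_add_left ?_ _
    split_ifs with h
    · refine card_le_one.2 fun X hX Y hY => ?_
      exact hP.eq_of_mem (mem_filter.1 hX).1 (mem_filter.1 hY).1 (mem_filter.1 hX).2
        (mem_filter.1 hY).2
    · refine (card_eq_zero.2 (filter_eq_empty_iff.2 fun X hX hr => ?_)).le
      exact h (mem_biUnion.2 ⟨X, hX, hr⟩)
  have := sum_le_sum hi
  rw [sum_add_distrib, sum_const, card_univ, Fintype.card_fin, smul_eq_mul, ← card_filter] at this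
  rw [sum_card_roots]
  omega

/-- A covering condition for a root vector `m` yields a packing with these roots. -/
theorem exists_packing {F : MixedGraph V E A} {k : ℕ} {m : V → ℕ} (hm : ∑ v, m v = k)
    (h : ∀ P, IsSubpartition P →
      k * P.card ≤ entering F.traversals P + ∑ v ∈ P.biUnion id, m v) :
    F.HasPacking k m m := by
  classical
  obtain ⟨D, hD, hdir, hDP⟩ := exists_orientation k m F.traversals F.isMixed_traversals h
  obtain ⟨r, hr⟩ : ∃ r : Fin k → V, ∀ v, (univ.filter fun i => r i = v).card = m v := by
    have e : Fin k ≃ Σ v, Fin (m v) := Fintype.equivOfCardEq (by simp [hm])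
    refine ⟨fun i => (e i).1, fun v => ?_⟩
    rw [← Fintype.card_subtype, ← Fintype.card_fin (m v)]
    exact Fintype.card_congr ((e.subtypeEquiv fun _ => Iff.rfl).trans
      (Equiv.sigmaSubtype v))
  have hmiss : ∀ X : Finset V, X.Nonempty → missing (fun i => {r i}) X ≤ arcsInto D X := by
    intro X hX
    -- One-member subpartitions suffice here: k - m(X) is the number of roots outside X.
    have h1 := hDP {X} (isSubpartition_singleton hX)
    have h2 : entering D {X} ≤ arcsInto D X := by
      refine le_trans (card_le_card (t := (D.filter fun a => a.2.1 ∉ X ∧ a.2.2 ∈ X).image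
        Prod.fst) fun ℓ hℓ => ?_) card_image_le
      obtain ⟨Y, hY, u, v, hmem, huv⟩ := (mem_filter.1 hℓ).2
      rw [mem_singleton.1 hY] at huv
      exact mem_image.2 ⟨(ℓ, u, v), mem_filter.2 ⟨hmem, huv⟩, rfl⟩
    have h3 := sum_card_roots r X
    simp only [hr] at h3
    have h4 := card_filter_add_card_filter_not (s := (univ : Finset (Fin k))) fun i => r i ∈ X
    simp only [missing, disjoint_singleton_left]
    simp only [card_singleton, singleton_biUnion, id, card_univ, Fintype.card_fin] at h1 h4
    omega
  obtain ⟨B, hB, hBD, hdis⟩ := exists_disjoint_branchings r D D Subset.rfl (fun i => {r i})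
    (fun _ => ∅) (fun i => IsBranching.root) (by simp) (by simp) hmiss
  refine ⟨fun i => F.spanningSubgraph (B i), r, fun i => ⟨rfl,
    isMixedArborescence_spanningSubgraph
      (fun ℓ u v hm => mem_traversals.1 (hD (hBD i hm))) (hB i)⟩, fun i j hij => ?_,
    fun v => ⟨(hr v).ge, (hr v).le⟩⟩
  -- The branchings are disjoint as sets of traversals; since `D` keeps a single direction of each
  -- link, they are disjoint as sets of links.
  have hcontra : ∀ ℓ, (∃ u v, (ℓ, u, v) ∈ B i) → ¬ ∃ u v, (ℓ, u, v) ∈ B j := by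
    rintro ℓ ⟨u, v, h1⟩ ⟨u', v', h2⟩
    obtain ⟨rfl, rfl⟩ := hdir ℓ u v u' v' (hBD i h1) (hBD j h2)
    exact disjoint_left.1 (hdis i j hij) h1 h2
  exact ⟨Set.disjoint_left.2 fun e => hcontra (Sum.inl e),
    Set.disjoint_left.2 fun a => hcontra (Sum.inr a)⟩

end MixedGraph

/-! ### The characterization -/

theorem theorem1p6 {V E A : Type*} [Fintype V] [DecidableEq V] [Nonempty V] [Finite E] [Finite A]
    (F : MixedGraph V E A) (k : ℕ) (f g : V → ℕ) (hfg : f ≤ g) :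
    F.HasPacking k f g ↔
      (∑ v, f v ≤ k) ∧
      (∀ P : Finset (Finset V), IsSubpartition P →
        (F.crossingEdges P : ℤ) + ∑ X ∈ P, (F.inDegree X : ℤ) ≥
          (k : ℤ) * ((P.card : ℤ) - 1) + ∑ v ∈ Finset.univ \ P.biUnion id, (f v : ℤ)) ∧
      (∀ P : Finset (Finset V), IsSubpartition P →
        (F.crossingEdges P : ℤ) + ∑ X ∈ P, (F.inDegree X : ℤ) ≥
          (k : ℤ) * (P.card : ℤ) - ∑ v ∈ P.biUnion id, (g v : ℤ)) := by
  cases nonempty_fintype E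
  cases nonempty_fintype A
  have hent : ∀ P, IsSubpartition P → (F.crossingEdges P : ℤ) + ∑ X ∈ P, (F.inDegree X : ℤ) =
      (entering F.traversals P : ℕ) := fun P hP => by
    rw [F.entering_traversals hP]
    push_cast
    rfl
  constructor
  · rintro ⟨T, r, hT, hdis, hr⟩
    have hsum : ∑ v, (univ.filter fun i => r i = v).card = k := by
      rw [sum_card_roots]
      simp
    refine ⟨hsum ▸ sum_le_sum fun v _ => (hr v).1, fun P hP => ?_, fun P hP => ?_⟩
    · have h1 := MixedGraph.le_entering_of_packing hT hdis hP
      have h2 := sum_sdiff (f := fun v => (univ.filter fun i => r i = v).card)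
        (subset_univ (P.biUnion id))
      have h3 : ∑ v ∈ univ \ P.biUnion id, f v ≤ _ := sum_le_sum fun v _ => (hr v).1
      rw [hent P hP, ← Nat.cast_sum]
      zify at h1 h2 h3 hsum ⊢
      linarith
    · have h1 := MixedGraph.le_entering_of_packing hT hdis hP
      have h3 : _ ≤ ∑ v ∈ P.biUnion id, g v := sum_le_sum fun v _ => (hr v).2
      rw [hent P hP, ← Nat.cast_sum]
      zify at h1 h3 ⊢
      linarith
  -- The first condition is the second one for the empty subpartition.
  · rintro ⟨-, hf, hg⟩
    obtain ⟨m, hfm, hmg, hm, hP⟩ := exists_roots F.isMixed_traversals k f g hfg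
      (fun P hP => by
        have := hf P hP
        rw [hent P hP, ← Nat.cast_sum] at this
        zify
        push_cast at this
        linarith)
      (fun P hP => by
        have := hg P hP
        rw [hent P hP, ← Nat.cast_sum] at this
        zify
        push_cast at this
        linarith)
    obtain ⟨T, r, hT, hdis, hr⟩ := MixedGraph.exists_packing hm hP
    exact ⟨T, r, hT, hdis, fun v => ⟨(hfm v).trans (hr v).1, (hr v).2.trans (hmg v)⟩⟩
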